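/- **Setting.** Let $G=(\mathbb V,\mathbb E)$ be a finite connected undirected simple graph on $n=|\mathbb V|$ vertices. For edge weights $w:\mathbb E\to\mathbb R$ let $d_{(G,w)}(u,v)$ be the minimum of $\sum_{e\in P}w(e)$ over all simple paths $P$ from $u$ to $v$ in $G$. Two weightings $w,w'$ of $G$ are *neighboring* if $\sum_{e\in\mathbb E}|w(e)-w'(e)|\le 1$. A randomized algorithm $\mathbb A$ is *$(\epsilon,\delta)$-differentially private* w.r.t. the weights if $\Pr[\mathbb A(w)\in O]\le e^{\epsilon}\Pr[\mathbb A(w')\in O]+\delta$ for all neighboring $w,w'$ and all measurable sets $O$ of outputs. $\mathrm{Lap}(\mu,b)$ is the distribution on $\mathbb R$ with density $\frac1{2b}e^{-|x-\mu|/b}$. **Algorithm 1** (input $G,w,\epsilon,\delta,\gamma$). Put $\epsilon'=\epsilon/2$. 1. Draw a set $\mathbb V_1\subseteq\mathbb V$ of $s$ vertices uniformly at random, where $s$ is $n^{1/2}$ rounded to an integer ($s=\lfloor\sqrt n\rfloor$ or $s=\lceil\sqrt n\rceil$). 2. Let $\mathbb E_1=\{\{u,v\}:u,v\in\mathbb V_1,\,u\ne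 v\}$ and $\mathbb E_0=\mathbb E\setminus\mathbb E_1$. Put $$\sigma_1=\frac{2\sqrt2\,n^{1/2}\sqrt{\log(1/\delta)}}{\epsilon'},\quad \mu_1=\sigma_1\log(n/\gamma),\qquad \sigma_0=\frac1{\epsilon'},\quad \mu_0=\sigma_0\log(n^2/\gamma).$$ 3. With independent noise variables $X_e$, where $X_e\sim\mathrm{Lap}(\mu_1,\sigma_1)$ for $e\in\mathbb E_1$ and $X_e\sim\mathrm{Lap}(\mu_0,\sigma_0)$ for $e\in\mathbb E_0$, set $w'(e)=d_{(G,w)}(u,v)+X_e$ for $e=\{u,v\}\in\mathbb E_1$ and $w'(e)=w(e)+X_e$ for $e\in\mathbb E_0$. 4. Publish the synthetic weighted graph $G'=(\mathbb V,\mathbb E_0\cup\mathbb E_1,w')$. The estimated distance $\hat d(u,v)$ is the shortest-path distance between $u$ and $v$ in $G'$. **Theorem.** There is an absolute constant $C>0$ such that for every $G$ as above, either rounding $s$ of $n^{1/2}$, and all $\epsilon>0$, $0<\delta\le\frac12$, $0<\gamma<1$: 1. if $\epsilon<2$, then Algorithm 1, which publishes $G'$, is $(\epsilon,\delta)$-differentially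 private w.r.t. the weights (over all real weightings of $G$); 2. for every nonnegative weighting $w$ of $G$, with probability at least $1-4\gamma$, $$|\hat d(u,v)-d_{(G,w)}(u,v)|\le C\,\epsilon^{-1}n^{1/2}\log^2(n/\gamma)\sqrt{\log(1/\delta)}\qquad\text{for all }u,v\in\mathbb V.$$ -/

import Mathlib

open MeasureTheory
open scoped ENNReal

noncomputable section

/-- The Laplace distribution on `ℝ` with location `μ` and scale `b > 0`, i.e. the measure with
density `x ↦ exp (-|x - μ| / b) / (2 b)`. -/
def laplaceMeasure (μ b : ℝ) : Measure ℝ :=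
  volume.withDensity fun x => ENNReal.ofReal (1 / (2 * b) * Real.exp (-|x - μ| / b))

namespace SimpleGraph

variable {V : Type*}

/-- Total weight of a walk. Edge weights are functions on `Sym2 V`; only the values on the edges
of the graph under consideration ever matter. -/
def walkWeight {G : SimpleGraph V} (w : Sym2 V → ℝ) {u v : V} (p : G.Walk u v) : ℝ :=
  (p.edges.map w).sum

/-- Weighted shortest-path distance: the least total weight of a (simple) path from `u` to `v`.
For a finite connected graph there are finitely many such paths, and at least one, so the
infimum is a minimum, also if some weights are negative. -/
def wdist (G : SimpleGraph V) (w : Sym2 V → ℝ) (u v : V) : ℝ :=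
  ⨅ p : G.Path u v, walkWeight w p.1

theorem wdist_comm (G : SimpleGraph V) (w : Sym2 V → ℝ) (u v : V) :
    wdist G w u v = wdist G w v u := by
  let e : G.Path u v ≃ G.Path v u :=
    { toFun := Path.reverse
      invFun := Path.reverse
      left_inv := fun p => Subtype.ext (Walk.reverse_reverse p.1)
      right_inv := fun p => Subtype.ext (Walk.reverse_reverse p.1) }
  refine Equiv.iInf_congr e fun p => ?_
  change walkWeight w p.1.reverse = walkWeight w p.1
  simp [walkWeight, Walk.edges_reverse, List.sum_reverse]

/-- `wdist` as a function of the unordered pair of endpoints. -/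
def wdistSym2 (G : SimpleGraph V) (w : Sym2 V → ℝ) : Sym2 V → ℝ :=
  Sym2.lift ⟨wdist G w, wdist_comm G w⟩

/-- The shortcut graph `(V, E₁)`: all pairs of distinct vertices of `V₁`. -/
def shortcutGraph (V₁ : Finset V) : SimpleGraph V where
  Adj u v := u ∈ V₁ ∧ v ∈ V₁ ∧ u ≠ v
  symm := ⟨fun _ _ h => ⟨h.2.1, h.1, h.2.2.symm⟩⟩
  loopless := ⟨fun _ h => h.2.2 rfl⟩

/-- A published synthetic graph: its topology together with its edge weights (set to `0` at
pairs that are not edges). -/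
abbrev WeightedGraph (V : Type*) : Type _ := SimpleGraph V × (Sym2 V → ℝ)

open Classical in
/-- The synthetic graph `G' = (V, E₀ ∪ E₁, w')` built from the weighted graph `(G, w)`, the sampled
vertex set `V₁` and the noise `X`, where `E₁` is the set of shortcut edges and `E₀ = E \ E₁`:
`w' e = APSP e + X e` for `e ∈ E₁` and `w' e = w e + X e` for `e ∈ E₀`. -/
def syntheticGraph (G : SimpleGraph V) (w : Sym2 V → ℝ) (V₁ : Finset V) (X : Sym2 V → ℝ) :
    WeightedGraph V :=
  (G ⊔ shortcutGraph V₁, fun e =>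
    if e ∈ (shortcutGraph V₁).edgeSet then wdistSym2 G w e + X e
    else if e ∈ G.edgeSet then w e + X e
    else 0)

variable [Fintype V]

/-- Scale of the noise on the shortcut edges: `2 √2 √n √(log (1/δ)) / ε'` with `ε' = ε / 2`. -/
def shortcutScale (n : ℕ) (ε δ : ℝ) : ℝ :=
  2 * √2 * √(n : ℝ) * √(Real.log (1 / δ)) / (ε / 2)

/-- Scale of the noise on the remaining original edges: `1 / ε'` with `ε' = ε / 2`. -/
def edgeScale (ε : ℝ) : ℝ := 1 / (ε / 2)

open Classical in
/-- The law of the noise `X` given `V₁`: independent coordinates, `Lap(μ₁, σ₁)` with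
`μ₁ = σ₁ log (n / γ)` on `E₁` and `Lap(μ₀, σ₀)` with `μ₀ = σ₀ log (n² / γ)` elsewhere.
(The coordinates at pairs that are not edges of the synthetic graph are never used.) -/
def noiseLaw (V₁ : Finset V) (ε δ γ : ℝ) : Measure (Sym2 V → ℝ) :=
  let n := Fintype.card V
  Measure.pi fun e =>
    if e ∈ (shortcutGraph V₁).edgeSet then
      laplaceMeasure (shortcutScale n ε δ * Real.log (n / γ)) (shortcutScale n ε δ)
    else
      laplaceMeasure (edgeScale ε * Real.log ((n : ℝ) ^ 2 / γ)) (edgeScale ε)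

/-- The law of the synthetic graph published by the algorithm on input `(G, w)`: first a set `V₁`
of `s` vertices is drawn uniformly at random, then the noise is drawn from `noiseLaw V₁`. -/
def privateAPSP (G : SimpleGraph V) (s : ℕ) (ε δ γ : ℝ) (w : Sym2 V → ℝ) :
    Measure (WeightedGraph V) :=
  ((Finset.univ.powersetCard s : Finset (Finset V)).card : ℝ≥0∞)⁻¹ •
    ∑ V₁ ∈ (Finset.univ.powersetCard s : Finset (Finset V)),
      (noiseLaw V₁ ε δ γ).map (syntheticGraph G w V₁)

open Classical in
/-- Two weightings of `G` are neighboring if they differ by at most `1` in `ℓ¹` norm. -/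
def Neighboring (G : SimpleGraph V) (w w' : Sym2 V → ℝ) : Prop :=
  ∑ e ∈ G.edgeFinset, |w e - w' e| ≤ 1

/-- `(ε, δ)`-differential privacy, with respect to the edge weights of the public graph `G`, of a
randomized algorithm `A`, given by the law `A w` of its output for each input weighting `w`. -/
def IsDP {O : Type*} [MeasurableSpace O] (G : SimpleGraph V) (ε δ : ℝ)
    (A : (Sym2 V → ℝ) → Measure O) : Prop :=
  ∀ w w' : Sym2 V → ℝ, Neighboring G w w' → ∀ S : Set O, MeasurableSet S →
    A w S ≤ ENNReal.ofReal (Real.exp ε) * A w' S + ENNReal.ofReal δ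

end SimpleGraph

end

/-!
Replacing the weighting by a neighboring one amounts to a deterministic shift of the noise. On the
edges outside of `E₁` this shift has `ℓ¹` norm at most `1`, and there the Laplace noise is purely
`(ε / 2)`-private. On the at most `n` shortcut edges the shift is only bounded by `1` in each
coordinate, since every distance is a `1`-Lipschitz function of the weights. There the privacy loss
is a sum of independent bounded, hence sub-Gaussian, variables `L` with `E[exp (-L)] = 1`, which
forces `E[L] ≤ η ^ 2 / 2` where `|L| ≤ η`; by the sub-Gaussian tail bound the sum is smaller than
`ε / 2` outside of an event of probability `δ`.

For the error, fix a geodesic for every pair of vertices. With probability at least `1 - γ` the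
sample meets the first `O(√n log (n / γ))` vertices of every geodesic with at least that many edges,
and with probability at least `1 - 2 γ` every noise variable lies between `0` and twice its mean.
Nonnegative noise cannot shorten a distance. Conversely, a geodesic followed from either end to the
sample, with a single shortcut edge in between, accumulates only the noise of these two short
segments and of that edge.
-/

namespace PrivateAPSP

open ProbabilityTheory SimpleGraph

theorem laplaceMeasure_lt_abs_sub (μ : ℝ) {b c : ℝ} (hb : 0 < b) (hc : 0 ≤ c) :
    laplaceMeasure μ b {x | c < |x - μ|} = ENNReal.ofReal (Real.exp (-(c / b))) := by
  set density : ℝ → ℝ := fun y => 1 / (2 * b) * Real.exp (-y / b)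
  have htail : ∫ x, (Set.Ioi c).indicator density |x - μ| = Real.exp (-(c / b)) := by
    rw [integral_sub_right_eq_self (fun x => (Set.Ioi c).indicator density |x|) μ,
      integral_comp_abs, setIntegral_indicator measurableSet_Ioi, Set.Ioi_inter_Ioi,
      max_eq_right hc]
    simp only [density, div_eq_inv_mul _ b, mul_neg, ← neg_mul]
    rw [integral_const_mul, integral_exp_mul_Ioi (by simpa using hb)]
    field_simp
  have hint : Integrable fun x => (Set.Ioi c).indicator density |x - μ| := by
    refine not_imp_comm.1 integral_undef ?_
    rw [htail]
    exact (Real.exp_pos _).ne'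
  have hnonneg : ∀ x, 0 ≤ (Set.Ioi c).indicator density |x - μ| := fun x =>
    Set.indicator_nonneg (fun y _ => by positivity) _
  have hmeas : MeasurableSet {x : ℝ | c < |x - μ|} := measurableSet_lt (by fun_prop) (by fun_prop)
  rw [← htail, ofReal_integral_eq_lintegral_ofReal hint (ae_of_all _ hnonneg), laplaceMeasure,
    withDensity_apply _ hmeas, ← lintegral_indicator hmeas]
  refine lintegral_congr fun x => ?_
  by_cases hx : c < |x - μ| <;> simp [Set.indicator, density, hx]

theorem isProbabilityMeasure_laplaceMeasure (μ : ℝ) {b : ℝ} (hb : 0 < b) :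
    IsProbabilityMeasure (laplaceMeasure μ b) := by
  have hne : ∀ᵐ x ∂laplaceMeasure μ b, 0 < |x - μ| := by
    refine (withDensity_absolutelyContinuous _ _).ae_le ?_
    filter_upwards [volume.ae_ne μ] with x hx
    exact abs_pos.2 (sub_ne_zero.2 hx)
  constructor
  rw [← measure_congr (Filter.eventuallyEq_univ.2 hne)]
  exact (laplaceMeasure_lt_abs_sub μ hb le_rfl).trans (by simp)

theorem laplaceMeasure_map_add_const (μ b c : ℝ) :
    (laplaceMeasure μ b).map (· + c) = laplaceMeasure (μ + c) b := by
  set density : ℝ → ℝ≥0∞ := fun x => ENNReal.ofReal (1 / (2 * b) * Real.exp (-|x - (μ + c)| / b))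
  have hdensity : laplaceMeasure μ b = volume.withDensity (density ∘ (· + c)) := by
    simp only [laplaceMeasure, density, Function.comp_def, add_sub_add_right_eq_sub]
  ext s hs
  rw [hdensity, laplaceMeasure, Measure.map_apply (measurable_add_const c) hs,
    withDensity_apply _ hs, withDensity_apply _ (measurable_add_const c hs)]
  exact (measurePreserving_add_right volume c).setLIntegral_comp_preimage hs (by fun_prop)

section PrivacyLoss

variable {α : Type*} [MeasurableSpace α]

/-- The tilt `exp L • μ` of `μ`. If two mechanisms have output laws `μ` and `withLogDensity μ L`,
then `L` is the privacy loss of the second with respect to the first. -/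
noncomputable def withLogDensity (μ : Measure α) (L : α → ℝ) : Measure α :=
  μ.withDensity fun x => ENNReal.ofReal (Real.exp (L x))

/-- The one-sided `(ε, δ)`-indistinguishability of `μ` from `ν`, that is, a bound by `ε` on their
`δ`-approximate max-divergence. -/
def ApproxMaxDivLE (ε δ : ℝ) (μ ν : Measure α) : Prop :=
  ∀ S : Set α, MeasurableSet S →
    μ S ≤ ENNReal.ofReal (Real.exp ε) * ν S + ENNReal.ofReal δ

theorem laplaceMeasure_add_eq_withLogDensity (μ b c : ℝ) :
    laplaceMeasure (μ + c) b =
      withLogDensity (laplaceMeasure μ b) fun x => (|x - μ| - |x - (μ + c)|) / b := by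
  rw [laplaceMeasure, laplaceMeasure, withLogDensity,
    ← withDensity_mul _ (by fun_prop) (by fun_prop)]
  congr 1
  funext x
  rw [Pi.mul_apply, ← ENNReal.ofReal_mul' (by positivity), mul_assoc, ← Real.exp_add]
  congr 3
  ring

theorem integral_exp_neg_withLogDensity (μ : Measure α) {L : α → ℝ} (hL : Measurable L) :
    ∫ x, Real.exp (-L x) ∂withLogDensity μ L = μ.real Set.univ := by
  rw [withLogDensity, integral_withDensity_eq_integral_toReal_smul (by fun_prop)
    (ae_of_all _ fun x => ENNReal.ofReal_lt_top)]
  simp only [ENNReal.toReal_ofReal (Real.exp_nonneg _), smul_eq_mul, ← Real.exp_add,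
    add_neg_cancel, Real.exp_zero, integral_const, mul_one]

theorem pi_withLogDensity {ι : Type*} [Fintype ι] {α : ι → Type*}
    [∀ i, MeasurableSpace (α i)] (μ : ∀ i, Measure (α i)) [∀ i, IsProbabilityMeasure (μ i)]
    {L : ∀ i, α i → ℝ} (hL : ∀ i, Measurable (L i))
    [∀ i, SigmaFinite (withLogDensity (μ i) (L i))] :
    Measure.pi (fun i => withLogDensity (μ i) (L i)) =
      withLogDensity (Measure.pi μ) fun x => ∑ i, L i (x i) := by
  refine Measure.pi_eq fun s hs => ?_
  set density : ∀ i, α i → ℝ≥0∞ := fun i =>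
    (s i).indicator fun y => ENNReal.ofReal (Real.exp (L i y))
  have hmeas : ∀ i, Measurable (density i) := fun i =>
    Measurable.indicator (by have := hL i; fun_prop) (hs i)
  have hprod : ∀ x, (Set.univ.pi s).indicator
      (fun x => ENNReal.ofReal (Real.exp (∑ i, L i (x i)))) x = ∏ i, density i (x i) := by
    intro x
    by_cases hx : x ∈ Set.univ.pi s
    · rw [Set.indicator_of_mem hx, Real.exp_sum,
        ENNReal.ofReal_prod_of_nonneg fun i _ => Real.exp_nonneg _]
      exact Finset.prod_congr rfl fun i _ =>
        (Set.indicator_of_mem (hx i (Set.mem_univ i))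
          fun y => ENNReal.ofReal (Real.exp (L i y))).symm
    · obtain ⟨i, hi⟩ : ∃ i, x i ∉ s i := by simpa using hx
      rw [Set.indicator_of_notMem hx]
      exact (Finset.prod_eq_zero (Finset.mem_univ i) (Set.indicator_of_notMem hi _)).symm
  rw [withLogDensity, withDensity_apply _ (MeasurableSet.univ_pi hs),
    ← lintegral_indicator (MeasurableSet.univ_pi hs), lintegral_congr hprod,
    lintegral_prod_eq_prod_lintegral_of_indepFun Finset.univ
      (fun i (x : ∀ i, α i) => density i (x i)) (iIndepFun_pi fun i => (hmeas i).aemeasurable)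
      fun i => (hmeas i).comp (measurable_pi_apply i)]
  refine Finset.prod_congr rfl fun i _ => ?_
  rw [withLogDensity, withDensity_apply _ (hs i), ← lintegral_indicator (hs i),
    ← (measurePreserving_eval μ i).lintegral_comp (hmeas i)]

theorem approxMaxDivLE_withLogDensity {μ : Measure α} {L : α → ℝ} (hL : Measurable L) {ε δ : ℝ}
    (htail : withLogDensity μ L {x | ε ≤ L x} ≤ ENNReal.ofReal δ) :
    ApproxMaxDivLE ε δ (withLogDensity μ L) μ := by
  intro S hS
  have hlt : MeasurableSet {x | L x < ε} := measurableSet_lt hL measurable_const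
  have hsub : S ⊆ (S ∩ {x | L x < ε}) ∪ {x | ε ≤ L x} := fun x hx =>
    (lt_or_ge (L x) ε).imp (fun h => ⟨hx, h⟩) id
  have hbulk : withLogDensity μ L (S ∩ {x | L x < ε}) ≤ ENNReal.ofReal (Real.exp ε) * μ S :=
    calc withLogDensity μ L (S ∩ {x | L x < ε})
        = ∫⁻ x in S ∩ {x | L x < ε}, ENNReal.ofReal (Real.exp (L x)) ∂μ :=
          withDensity_apply _ (hS.inter hlt)
      _ ≤ ∫⁻ _ in S ∩ {x | L x < ε}, ENNReal.ofReal (Real.exp ε) ∂μ :=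
          setLIntegral_mono measurable_const fun x hx =>
            ENNReal.ofReal_le_ofReal (Real.exp_le_exp.2 hx.2.le)
      _ = ENNReal.ofReal (Real.exp ε) * μ (S ∩ {x | L x < ε}) := setLIntegral_const _ _
      _ ≤ ENNReal.ofReal (Real.exp ε) * μ S := by gcongr; exact Set.inter_subset_left
  exact (measure_mono hsub).trans ((measure_union_le _ _).trans (add_le_add hbulk htail))

theorem approxMaxDivLE_map {β : Type*} [MeasurableSpace β] {μ ν : Measure α} {ε δ : ℝ}
    (h : ApproxMaxDivLE ε δ μ ν) {f : α → β} (hf : Measurable f) :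
    ApproxMaxDivLE ε δ (μ.map f) (ν.map f) := fun S hS => by
  simpa only [Measure.map_apply hf hS] using h _ (hf hS)

theorem approxMaxDivLE_average {κ : Type*} {F : Finset κ} {μ ν : κ → Measure α} {ε δ : ℝ}
    (h : ∀ k ∈ F, ApproxMaxDivLE ε δ (μ k) (ν k)) :
    ApproxMaxDivLE ε δ ((F.card : ℝ≥0∞)⁻¹ • ∑ k ∈ F, μ k) ((F.card : ℝ≥0∞)⁻¹ • ∑ k ∈ F, ν k) := by
  intro S hS
  simp only [Measure.smul_apply, Measure.finsetSum_apply, smul_eq_mul]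
  calc (F.card : ℝ≥0∞)⁻¹ * ∑ k ∈ F, μ k S
      ≤ (F.card : ℝ≥0∞)⁻¹ *
          ∑ k ∈ F, (ENNReal.ofReal (Real.exp ε) * ν k S + ENNReal.ofReal δ) := by
        gcongr with k hk
        exact h k hk S hS
    _ = ENNReal.ofReal (Real.exp ε) * ((F.card : ℝ≥0∞)⁻¹ * ∑ k ∈ F, ν k S) +
          (F.card : ℝ≥0∞)⁻¹ * F.card * ENNReal.ofReal δ := by
        rw [Finset.sum_add_distrib, ← Finset.mul_sum, Finset.sum_const, nsmul_eq_mul]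
        ring
    _ ≤ ENNReal.ofReal (Real.exp ε) * ((F.card : ℝ≥0∞)⁻¹ * ∑ k ∈ F, ν k S) +
          ENNReal.ofReal δ := by
        gcongr
        exact mul_le_of_le_one_left' (ENNReal.inv_mul_le_one _)

end PrivacyLoss

section BoundedPrivacyLoss

variable {Ω : Type*} [MeasurableSpace Ω] {P : Measure Ω} [IsProbabilityMeasure P]

theorem hasSubgaussianMGF_sub_integral_of_abs_le {X : Ω → ℝ} (hX : AEMeasurable X P) {η : ℝ}
    (hη : ∀ ω, |X ω| ≤ η) :
    HasSubgaussianMGF (fun ω => X ω - P[X]) (‖η‖₊ ^ 2) P := by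
  have h := hasSubgaussianMGF_of_mem_Icc hX (ae_of_all _ fun ω => abs_le.1 (hη ω))
  rwa [sub_neg_eq_add, ← two_mul, nnnorm_mul, Real.nnnorm_two, mul_div_cancel_left₀ _ two_ne_zero]
    at h

theorem integral_le_of_integral_exp_neg_eq_one {X : Ω → ℝ} (hX : AEMeasurable X P) {η : ℝ}
    (hη : ∀ ω, |X ω| ≤ η) (hone : ∫ ω, Real.exp (-X ω) ∂P = 1) : P[X] ≤ η ^ 2 / 2 := by
  have h := (hasSubgaussianMGF_sub_integral_of_abs_le hX hη).mgf_le (-1)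
  have hmgf : mgf (fun ω => X ω - P[X]) P (-1) = Real.exp P[X] := by
    simp only [mgf, mul_sub, neg_mul, one_mul, sub_neg_eq_add, Real.exp_add]
    rw [integral_mul_const, hone, one_mul]
  rw [hmgf, Real.exp_le_exp] at h
  simpa using h

variable {ι : Type*} {X : ι → Ω → ℝ} {A : Finset ι} {η : ι → ℝ}

theorem measureReal_le_sum_le_of_integral_exp_neg_eq_one (hindep : iIndepFun X P)
    (hX : ∀ i ∈ A, AEMeasurable (X i) P) (hη : ∀ i ∈ A, ∀ ω, |X i ω| ≤ η i)
    (hone : ∀ i ∈ A, ∫ ω, Real.exp (-X i ω) ∂P = 1) {v ε : ℝ} (hv : 0 < v)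
    (hsum : ∑ i ∈ A, η i ^ 2 ≤ v) (hε : v / 2 ≤ ε) :
    P.real {ω | ε ≤ ∑ i ∈ A, X i ω} ≤ Real.exp (-(ε - v / 2) ^ 2 / (2 * v)) := by
  have hmean : ∑ i ∈ A, P[X i] ≤ v / 2 :=
    (Finset.sum_le_sum fun i hi =>
      integral_le_of_integral_exp_neg_eq_one (hX i hi) (hη i hi) (hone i hi)).trans
      (by rw [← Finset.sum_div]; gcongr)
  have hindep' : iIndepFun (fun i ω => X i ω - P[X i]) P :=
    hindep.comp (fun i x => x - ∫ ω, X i ω ∂P) fun i => measurable_id.sub_const _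
  have hsub : HasSubgaussianMGF (fun ω => ∑ i ∈ A, (X i ω - P[X i])) (∑ i ∈ A, ‖η i‖₊ ^ 2) P :=
    HasSubgaussianMGF.sum_of_iIndepFun hindep' fun i hi =>
      hasSubgaussianMGF_sub_integral_of_abs_le (hX i hi) (hη i hi)
  have hsub' : HasSubgaussianMGF (fun ω => ∑ i ∈ A, (X i ω - P[X i])) v.toNNReal P :=
    ⟨hsub.integrable_exp_mul, fun t => (hsub.mgf_le t).trans (by
      rw [Real.coe_toNNReal v hv.le]
      gcongr
      simpa using hsum)⟩
  calc P.real {ω | ε ≤ ∑ i ∈ A, X i ω}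
      ≤ P.real {ω | ε - v / 2 ≤ ∑ i ∈ A, (X i ω - P[X i])} := by
        refine measureReal_mono fun ω (hω : ε ≤ _) => ?_
        simp only [Set.mem_ofPred_eq, Finset.sum_sub_distrib]
        linarith
    _ ≤ Real.exp (-(ε - v / 2) ^ 2 / (2 * v)) := by
        simpa only [Real.coe_toNNReal v hv.le] using hsub'.measure_ge_le (sub_nonneg.2 hε)

theorem measureReal_le_sum_le_of_sum_sq_le (hindep : iIndepFun X P)
    (hX : ∀ i ∈ A, AEMeasurable (X i) P) (hη : ∀ i ∈ A, ∀ ω, |X i ω| ≤ η i)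
    (hone : ∀ i ∈ A, ∫ ω, Real.exp (-X i ω) ∂P = 1) {ε δ : ℝ} (hε : 0 < ε) (hδ : 0 < δ)
    (hεδ : ε ≤ 8 * Real.log (1 / δ))
    (hsum : ∑ i ∈ A, η i ^ 2 ≤ ε ^ 2 / (8 * Real.log (1 / δ))) :
    P.real {ω | ε ≤ ∑ i ∈ A, X i ω} ≤ δ := by
  set v := ε ^ 2 / (8 * Real.log (1 / δ)) with hv
  have hlog : 0 < Real.log (1 / δ) := by linarith
  have hvpos : 0 < v := by positivity
  have hvε : v ≤ ε := by
    rw [hv, div_le_iff₀ (by positivity)]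
    nlinarith
  refine (measureReal_le_sum_le_of_integral_exp_neg_eq_one hindep hX hη hone hvpos hsum
    (by linarith)).trans ?_
  rw [← Real.le_log_iff_exp_le hδ, neg_div, neg_le, ← Real.log_inv, ← one_div]
  calc Real.log (1 / δ) = (ε / 2) ^ 2 / (2 * v) := by rw [hv]; field_simp; norm_num
    _ ≤ (ε - v / 2) ^ 2 / (2 * v) := by gcongr; linarith

end BoundedPrivacyLoss

section Composition

variable {ι : Type*} [Fintype ι] [DecidableEq ι]

theorem approxMaxDivLE_pi_withLogDensity {α : ι → Type*} [∀ i, MeasurableSpace (α i)]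
    {μ : ∀ i, Measure (α i)} [∀ i, IsProbabilityMeasure (μ i)] {L : ∀ i, α i → ℝ}
    [∀ i, IsProbabilityMeasure (withLogDensity (μ i) (L i))] (hL : ∀ i, Measurable (L i))
    {η : ι → ℝ} (hη : ∀ i x, |L i x| ≤ η i) (A : Finset ι) {ε₀ ε₁ δ : ℝ} (hε₁ : 0 < ε₁)
    (hδ : 0 < δ) (hεδ : ε₁ ≤ 8 * Real.log (1 / δ))
    (hA : ∑ i ∈ A, η i ^ 2 ≤ ε₁ ^ 2 / (8 * Real.log (1 / δ))) (hAc : ∑ i ∈ Aᶜ, η i ≤ ε₀) :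
    ApproxMaxDivLE (ε₀ + ε₁) δ (Measure.pi fun i => withLogDensity (μ i) (L i))
      (Measure.pi μ) := by
  set Q := Measure.pi fun i => withLogDensity (μ i) (L i) with hQ
  have hLeval : ∀ i, Measurable fun x : ∀ i, α i => L i (x i) := fun i =>
    (hL i).comp (measurable_pi_apply i)
  have hone : ∀ i, ∫ x, Real.exp (-L i (x i)) ∂Q = 1 := fun i => by
    rw [hQ, integral_comp_eval (f := fun y => Real.exp (-L i y))
      (by have := hL i; fun_prop), integral_exp_neg_withLogDensity _ (hL i), probReal_univ]
  have htail : Q.real {x | ε₁ ≤ ∑ i ∈ A, L i (x i)} ≤ δ :=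
    measureReal_le_sum_le_of_sum_sq_le (iIndepFun_pi fun i => (hL i).aemeasurable)
      (fun i _ => (hLeval i).aemeasurable) (fun i _ x => hη i (x i)) (fun i _ => hone i)
      hε₁ hδ hεδ hA
  have hrest : ∀ x : ∀ i, α i, ∑ i ∈ Aᶜ, L i (x i) ≤ ε₀ := fun x =>
    (Finset.sum_le_sum fun i _ => (le_abs_self _).trans (hη i (x i))).trans hAc
  rw [hQ, pi_withLogDensity μ hL]
  refine approxMaxDivLE_withLogDensity (Finset.measurable_fun_sum _ fun i _ => hLeval i) ?_
  rw [← pi_withLogDensity μ hL, ← hQ, ← ofReal_measureReal]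
  refine ENNReal.ofReal_le_ofReal ((measureReal_mono fun x hx => ?_).trans htail)
  have hsplit := Finset.sum_add_sum_compl A fun i => L i (x i)
  simp only [Set.mem_ofPred_eq] at hx ⊢
  linarith [hrest x]

theorem abs_abs_sub_abs_sub_add_div_le (x m c : ℝ) {b : ℝ} (hb : 0 < b) :
    |(|x - m| - |x - (m + c)|) / b| ≤ |c| / b := by
  rw [abs_div, abs_of_pos hb]
  refine div_le_div_of_nonneg_right ?_ hb.le
  simpa using abs_abs_sub_abs_le (x - m) (x - (m + c))

theorem approxMaxDivLE_pi_laplaceMeasure_map_add (m c : ι → ℝ) {b : ι → ℝ} (hb : ∀ i, 0 < b i)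
    (A : Finset ι) {ε₀ ε₁ δ : ℝ} (hε₁ : 0 < ε₁) (hδ : 0 < δ) (hεδ : ε₁ ≤ 8 * Real.log (1 / δ))
    (hA : ∑ i ∈ A, (|c i| / b i) ^ 2 ≤ ε₁ ^ 2 / (8 * Real.log (1 / δ)))
    (hAc : ∑ i ∈ Aᶜ, |c i| / b i ≤ ε₀) :
    ApproxMaxDivLE (ε₀ + ε₁) δ
      ((Measure.pi fun i => laplaceMeasure (m i) (b i)).map (· + c))
      (Measure.pi fun i => laplaceMeasure (m i) (b i)) := by
  set L : ι → ℝ → ℝ := fun i x => (|x - m i| - |x - (m i + c i)|) / b i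
  have hL : ∀ i, Measurable (L i) := fun i => by fun_prop
  have hprob : ∀ i m, IsProbabilityMeasure (laplaceMeasure m (b i)) := fun i m =>
    isProbabilityMeasure_laplaceMeasure m (hb i)
  have hshift : ∀ i, (laplaceMeasure (m i) (b i)).map (· + c i) =
      withLogDensity (laplaceMeasure (m i) (b i)) (L i) := fun i => by
    rw [laplaceMeasure_map_add_const, laplaceMeasure_add_eq_withLogDensity]
  have htilt : ∀ i, IsProbabilityMeasure (withLogDensity (laplaceMeasure (m i) (b i)) (L i)) :=
    fun i => by rw [← hshift, laplaceMeasure_map_add_const]; infer_instance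
  have hpi : (Measure.pi fun i => laplaceMeasure (m i) (b i)).map (· + c) =
      Measure.pi fun i => withLogDensity (laplaceMeasure (m i) (b i)) (L i) := by
    have : ∀ i, SigmaFinite ((laplaceMeasure (m i) (b i)).map (· + c i)) := fun i => by
      rw [hshift]; infer_instance
    simp_rw [← hshift]
    exact (Measure.pi_map_pi fun i => (measurable_add_const (c i)).aemeasurable)
  rw [hpi]
  exact approxMaxDivLE_pi_withLogDensity hL
    (fun i x => abs_abs_sub_abs_sub_add_div_le x (m i) (c i) (hb i)) A hε₁ hδ hεδ hA hAc

end Composition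

section Distance

variable {V : Type*} {G : SimpleGraph V} {w : Sym2 V → ℝ}

theorem walkWeight_nil (u : V) : walkWeight w (Walk.nil : G.Walk u u) = 0 := by
  simp [walkWeight]

theorem walkWeight_cons {u v x : V} (h : G.Adj u v) (p : G.Walk v x) :
    walkWeight w (Walk.cons h p) = w s(u, v) + walkWeight w p := by
  simp [walkWeight]

theorem walkWeight_append {u v x : V} (p : G.Walk u v) (q : G.Walk v x) :
    walkWeight w (p.append q) = walkWeight w p + walkWeight w q := by
  simp [walkWeight]

theorem walkWeight_bypass_le [DecidableEq V] (hw : ∀ e ∈ G.edgeSet, 0 ≤ w e) {u v : V}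
    (p : G.Walk u v) : walkWeight w p.bypass ≤ walkWeight w p := by
  refine (p.edges_bypass_sublist_edges.map w).sum_le_sum fun x hx => ?_
  obtain ⟨e, he, rfl⟩ := List.mem_map.1 hx
  exact hw e (p.edges_subset_edgeSet he)

theorem le_walkWeight {f : V → V → ℝ} (hself : ∀ u, f u u ≤ 0)
    (htriangle : ∀ u v x, f u x ≤ f u v + f v x) (hadj : ∀ u v, G.Adj u v → f u v ≤ w s(u, v))
    {u v : V} (p : G.Walk u v) : f u v ≤ walkWeight w p := by
  induction p with
  | nil => exact (hself _).trans_eq (walkWeight_nil _).symm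
  | cons h p ih =>
    rw [walkWeight_cons]
    exact (htriangle _ _ _).trans (add_le_add (hadj _ _ h) ih)

theorem wdist_self (u : V) : wdist G w u u = 0 := by
  have h : ∀ p : G.Path u u, walkWeight w p.1 = 0 := fun p => by
    rw [p.loop_eq]
    exact walkWeight_nil u
  have : Nonempty (G.Path u u) := ⟨Path.nil⟩
  simp only [wdist, h, ciInf_const]

variable [Finite V]

theorem finite_path (u v : V) : Finite (G.Path u v) := by
  classical
  have := Fintype.ofFinite V
  infer_instance

theorem wdist_le_walkWeight_path {u v : V} (p : G.Path u v) :
    wdist G w u v ≤ walkWeight w p.1 :=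
  have := finite_path (G := G) u v
  ciInf_le (Set.finite_range _).bddBelow p

theorem exists_path_walkWeight_eq_wdist (hG : G.Connected) (w : Sym2 V → ℝ) (u v : V) :
    ∃ p : G.Path u v, walkWeight w p.1 = wdist G w u v := by
  classical
  have := finite_path (G := G) u v
  have : Nonempty (G.Path u v) := ⟨(hG u v).some.toPath⟩
  exact exists_eq_ciInf_of_finite

theorem le_wdist (hG : G.Connected) {f : V → V → ℝ} (hself : ∀ u, f u u ≤ 0)
    (htriangle : ∀ u v x, f u x ≤ f u v + f v x) (hadj : ∀ u v, G.Adj u v → f u v ≤ w s(u, v))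
    (u v : V) : f u v ≤ wdist G w u v := by
  obtain ⟨p, hp⟩ := exists_path_walkWeight_eq_wdist hG w u v
  exact hp ▸ le_walkWeight hself htriangle hadj p.1

theorem wdist_le_walkWeight (hw : ∀ e ∈ G.edgeSet, 0 ≤ w e) {u v : V} (p : G.Walk u v) :
    wdist G w u v ≤ walkWeight w p := by
  classical
  exact (wdist_le_walkWeight_path p.toPath).trans (walkWeight_bypass_le hw p)

theorem wdist_triangle (hG : G.Connected) (hw : ∀ e ∈ G.edgeSet, 0 ≤ w e) (u v x : V) :
    wdist G w u x ≤ wdist G w u v + wdist G w v x := by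
  obtain ⟨p, hp⟩ := exists_path_walkWeight_eq_wdist hG w u v
  obtain ⟨q, hq⟩ := exists_path_walkWeight_eq_wdist hG w v x
  rw [← hp, ← hq, ← walkWeight_append]
  exact wdist_le_walkWeight hw _

theorem wdist_nonneg (hG : G.Connected) (hw : ∀ e ∈ G.edgeSet, 0 ≤ w e) (u v : V) :
    0 ≤ wdist G w u v :=
  le_wdist hG (f := 0) (fun _ => le_rfl) (fun _ _ _ => (add_zero _).ge)
    (fun u v h => hw s(u, v) h) u v

theorem wdist_le_of_adj (hw : ∀ e ∈ G.edgeSet, 0 ≤ w e) {u v : V} (h : G.Adj u v) :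
    wdist G w u v ≤ w s(u, v) := by
  simpa [walkWeight] using wdist_le_walkWeight hw h.toWalk

end Distance

section Perturbation

variable {V : Type*} [Fintype V] {G : SimpleGraph V} {w w' : Sym2 V → ℝ}

open Classical in
theorem walkWeight_sub_walkWeight_le {u v : V} (p : G.Path u v) :
    walkWeight w p.1 - walkWeight w' p.1 ≤ ∑ e ∈ G.edgeFinset, |w e - w' e| := by
  have hsum : ∀ f : Sym2 V → ℝ, walkWeight f p.1 = ∑ e ∈ p.1.edges.toFinset, f e := fun f =>
    (List.sum_toFinset f p.2.isTrail.edges_nodup).symm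
  have hedges : p.1.edges.toFinset ⊆ G.edgeFinset := fun e he =>
    mem_edgeFinset.2 (p.1.edges_subset_edgeSet (List.mem_toFinset.1 he))
  rw [hsum, hsum, ← Finset.sum_sub_distrib]
  exact (Finset.sum_le_sum fun e _ => le_abs_self _).trans
    (Finset.sum_le_sum_of_subset_of_nonneg hedges fun e _ _ => abs_nonneg _)

open Classical in
theorem wdist_sub_wdist_le (hG : G.Connected) (w w' : Sym2 V → ℝ) (u v : V) :
    wdist G w u v - wdist G w' u v ≤ ∑ e ∈ G.edgeFinset, |w e - w' e| := by
  obtain ⟨p, hp⟩ := exists_path_walkWeight_eq_wdist hG w' u v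
  rw [← hp]
  exact (sub_le_sub_right (wdist_le_walkWeight_path p) _).trans (walkWeight_sub_walkWeight_le p)

theorem neighboring_symm (h : Neighboring G w w') : Neighboring G w' w := by
  simpa only [Neighboring, abs_sub_comm] using h

theorem abs_wdistSym2_sub_le_one (hG : G.Connected) (h : Neighboring G w w') (e : Sym2 V) :
    |wdistSym2 G w e - wdistSym2 G w' e| ≤ 1 := by
  induction e with
  | _ u v =>
    exact abs_sub_le_iff.2 ⟨(wdist_sub_wdist_le hG w w' u v).trans h,
      (wdist_sub_wdist_le hG w' w u v).trans (neighboring_symm h)⟩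

end Perturbation

section Privacy

variable {V : Type*} {G : SimpleGraph V} {w w' : Sym2 V → ℝ}

/-- The change of the noise that compensates, in the synthetic graph sampled with `V₁`, for
replacing the weighting `w` by `w'`. -/
noncomputable def weightShift (G : SimpleGraph V) (V₁ : Finset V) (w w' : Sym2 V → ℝ) :
    Sym2 V → ℝ :=
  (syntheticGraph G w V₁ 0).2 - (syntheticGraph G w' V₁ 0).2

theorem syntheticGraph_eq_add_weightShift (G : SimpleGraph V) (w w' : Sym2 V → ℝ) (V₁ : Finset V)
    (X : Sym2 V → ℝ) :
    syntheticGraph G w V₁ X = syntheticGraph G w' V₁ (X + weightShift G V₁ w w') := by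
  refine Prod.ext rfl (funext fun e => ?_)
  simp only [syntheticGraph, weightShift, Pi.add_apply, Pi.sub_apply, Pi.zero_apply]
  split_ifs <;> ring

theorem measurable_syntheticGraph (G : SimpleGraph V) (w : Sym2 V → ℝ) (V₁ : Finset V) :
    Measurable (syntheticGraph G w V₁) := by
  refine measurable_const.prodMk (measurable_pi_lambda _ fun e => ?_)
  split_ifs <;> fun_prop

open Classical in
theorem card_edgeFinset_shortcutGraph_le [Fintype V] (V₁ : Finset V) :
    (shortcutGraph V₁).edgeFinset.card ≤ V₁.card.choose 2 := by
  rw [← Sym2.card_image_offDiag]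
  refine Finset.card_le_card fun e he => ?_
  induction e with
  | _ u v =>
    exact Finset.mem_image.2 ⟨(u, v), Finset.mem_offDiag.2 (mem_edgeFinset.1 he), rfl⟩

variable [Fintype V]

theorem abs_weightShift_le_one (hG : G.Connected) (hw : Neighboring G w w') {V₁ : Finset V}
    {e : Sym2 V} (he : e ∈ (shortcutGraph V₁).edgeSet) : |weightShift G V₁ w w' e| ≤ 1 := by
  simpa [weightShift, syntheticGraph, he] using abs_wdistSym2_sub_le_one hG hw e

open Classical in
theorem sum_abs_weightShift_le_one (hw : Neighboring G w w') (V₁ : Finset V) :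
    ∑ e ∈ (shortcutGraph V₁).edgeFinsetᶜ, |weightShift G V₁ w w' e| ≤ 1 := by
  have hterm : ∀ e ∈ (shortcutGraph V₁).edgeFinsetᶜ, |weightShift G V₁ w w' e| =
      if e ∈ G.edgeFinset then |w e - w' e| else 0 := fun e he => by
    have he' : e ∉ (shortcutGraph V₁).edgeSet := by simpa using he
    simp only [weightShift, syntheticGraph, Pi.sub_apply, he', if_false, Pi.zero_apply, add_zero,
      mem_edgeFinset]
    split_ifs <;> simp
  rw [Finset.sum_congr rfl hterm, ← Finset.sum_filter]
  refine (Finset.sum_le_sum_of_subset_of_nonneg (fun e he => ?_) fun e _ _ => abs_nonneg _).trans hw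
  exact (Finset.mem_filter.1 he).2

theorem edgeScale_pos {ε : ℝ} (hε : 0 < ε) : 0 < edgeScale ε := by
  unfold edgeScale
  positivity

theorem shortcutScale_pos {n : ℕ} (hn : 0 < n) {ε δ : ℝ} (hε : 0 < ε)
    (hδ : 0 < Real.log (1 / δ)) : 0 < shortcutScale n ε δ := by
  unfold shortcutScale
  positivity

theorem shortcutScale_sq (n : ℕ) (ε : ℝ) {δ : ℝ} (hδ : 0 ≤ Real.log (1 / δ)) :
    shortcutScale n ε δ ^ 2 = n / ((ε / 2) ^ 2 / (8 * Real.log (1 / δ))) := by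
  simp only [shortcutScale, div_pow, mul_pow, Real.sq_sqrt hδ, Real.sq_sqrt (Nat.cast_nonneg n),
    Real.sq_sqrt zero_le_two]
  rw [div_div_eq_mul_div (n : ℝ)]
  congr 1
  ring

open Classical in
/-- The location parameters of the noise coordinates. -/
noncomputable def noiseMean (V₁ : Finset V) (ε δ γ : ℝ) : Sym2 V → ℝ := fun e =>
  if e ∈ (shortcutGraph V₁).edgeSet then
    shortcutScale (Fintype.card V) ε δ * Real.log (Fintype.card V / γ)
  else edgeScale ε * Real.log ((Fintype.card V : ℝ) ^ 2 / γ)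

open Classical in
/-- The scale parameters of the noise coordinates. -/
noncomputable def noiseScale (V₁ : Finset V) (ε δ : ℝ) : Sym2 V → ℝ := fun e =>
  if e ∈ (shortcutGraph V₁).edgeSet then shortcutScale (Fintype.card V) ε δ else edgeScale ε

theorem noiseLaw_eq_pi (V₁ : Finset V) (ε δ γ : ℝ) :
    noiseLaw V₁ ε δ γ = Measure.pi fun e =>
      laplaceMeasure (noiseMean V₁ ε δ γ e) (noiseScale V₁ ε δ e) := by
  refine congrArg Measure.pi (funext fun e => ?_)
  unfold noiseMean noiseScale
  split_ifs <;> rfl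

theorem noiseScale_pos [Nonempty V] (V₁ : Finset V) {ε δ : ℝ} (hε : 0 < ε)
    (hδ : 0 < Real.log (1 / δ)) (e : Sym2 V) : 0 < noiseScale V₁ ε δ e := by
  unfold noiseScale
  split_ifs
  · exact shortcutScale_pos Fintype.card_pos hε hδ
  · exact edgeScale_pos hε

open Classical in
theorem sum_sq_abs_weightShift_div_noiseScale_le [Nonempty V] (hG : G.Connected)
    (hw : Neighboring G w w') {V₁ : Finset V} (hV₁ : V₁.card.choose 2 ≤ Fintype.card V)
    {ε δ : ℝ} (hε : 0 < ε) (hδ : 0 < Real.log (1 / δ)) :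
    ∑ e ∈ (shortcutGraph V₁).edgeFinset, (|weightShift G V₁ w w' e| / noiseScale V₁ ε δ e) ^ 2 ≤
      (ε / 2) ^ 2 / (8 * Real.log (1 / δ)) := by
  have : (0 : ℝ) < Fintype.card V := by exact_mod_cast Fintype.card_pos
  have hterm : ∀ e ∈ (shortcutGraph V₁).edgeFinset,
      (|weightShift G V₁ w w' e| / noiseScale V₁ ε δ e) ^ 2 ≤
        1 / shortcutScale (Fintype.card V) ε δ ^ 2 := fun e he => by
    have he' := mem_edgeFinset.1 he
    rw [noiseScale, if_pos he', div_pow]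
    have := abs_weightShift_le_one hG hw he'
    gcongr
    exact pow_le_one₀ (abs_nonneg _) this
  calc _ ≤ (shortcutGraph V₁).edgeFinset.card • (1 / shortcutScale (Fintype.card V) ε δ ^ 2) :=
        Finset.sum_le_card_nsmul _ _ _ hterm
    _ ≤ Fintype.card V * (1 / shortcutScale (Fintype.card V) ε δ ^ 2) := by
        rw [nsmul_eq_mul]
        gcongr
        exact (card_edgeFinset_shortcutGraph_le V₁).trans hV₁
    _ = _ := by
        rw [shortcutScale_sq _ _ hδ.le]
        field_simp

open Classical in
theorem sum_abs_weightShift_div_noiseScale_le (hw : Neighboring G w w') (V₁ : Finset V)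
    {ε : ℝ} (hε : 0 ≤ ε) (δ : ℝ) :
    ∑ e ∈ (shortcutGraph V₁).edgeFinsetᶜ, |weightShift G V₁ w w' e| / noiseScale V₁ ε δ e ≤
      ε / 2 := by
  have hterm : ∀ e ∈ (shortcutGraph V₁).edgeFinsetᶜ,
      |weightShift G V₁ w w' e| / noiseScale V₁ ε δ e =
        |weightShift G V₁ w w' e| * (ε / 2) := fun e he => by
    have he' : e ∉ (shortcutGraph V₁).edgeSet := by simpa using he
    rw [noiseScale, if_neg he', edgeScale, div_div_eq_mul_div, div_one]
  rw [Finset.sum_congr rfl hterm, ← Finset.sum_mul]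
  exact mul_le_of_le_one_left (by positivity) (sum_abs_weightShift_le_one hw V₁)

theorem approxMaxDivLE_map_syntheticGraph (hG : G.Connected) (hw : Neighboring G w w')
    {V₁ : Finset V} (hV₁ : V₁.card.choose 2 ≤ Fintype.card V) {ε δ : ℝ} (hε : 0 < ε) (hδ : 0 < δ)
    (hεδ : ε ≤ 16 * Real.log (1 / δ)) (γ : ℝ) :
    ApproxMaxDivLE ε δ ((noiseLaw V₁ ε δ γ).map (syntheticGraph G w V₁))
      ((noiseLaw V₁ ε δ γ).map (syntheticGraph G w' V₁)) := by
  classical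
  have := hG.nonempty
  have hlog : 0 < Real.log (1 / δ) := by linarith
  have hnoise : ApproxMaxDivLE ε δ ((noiseLaw V₁ ε δ γ).map (· + weightShift G V₁ w w'))
      (noiseLaw V₁ ε δ γ) := by
    have h := approxMaxDivLE_pi_laplaceMeasure_map_add (noiseMean V₁ ε δ γ)
      (weightShift G V₁ w w') (noiseScale_pos V₁ hε hlog) (shortcutGraph V₁).edgeFinset
      (half_pos hε) hδ (by linarith)
      (sum_sq_abs_weightShift_div_noiseScale_le hG hw hV₁ hε hlog)
      (sum_abs_weightShift_div_noiseScale_le hw V₁ hε.le δ)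
    rwa [add_halves, ← noiseLaw_eq_pi] at h
  have hcomp : syntheticGraph G w V₁ = syntheticGraph G w' V₁ ∘ (· + weightShift G V₁ w w') :=
    funext (syntheticGraph_eq_add_weightShift G w w' V₁)
  rw [hcomp, ← Measure.map_map (measurable_syntheticGraph G w' V₁) (measurable_add_const _)]
  exact approxMaxDivLE_map hnoise (measurable_syntheticGraph G w' V₁)

theorem isDP_privateAPSP (hG : G.Connected) {s : ℕ} (hs : s.choose 2 ≤ Fintype.card V) {ε δ : ℝ}
    (hε : 0 < ε) (hδ : 0 < δ) (hεδ : ε ≤ 16 * Real.log (1 / δ)) (γ : ℝ) :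
    IsDP G ε δ (privateAPSP G s ε δ γ) := fun _ _ hw =>
  approxMaxDivLE_average fun _ hV₁ =>
    approxMaxDivLE_map_syntheticGraph hG hw ((Finset.mem_powersetCard.1 hV₁).2.symm ▸ hs) hε hδ
      hεδ γ

end Privacy

section Shortcutting

variable {V : Type*} {G : SimpleGraph V} {w X : Sym2 V → ℝ} {V₁ : Finset V} {M₀ M₁ : ℝ}
  {H : WeightedGraph V}

/-- `H` extends `(G, w)` by edges between all pairs of vertices of `V₁`. Its weights are at least
the distances in `(G, w)`; they exceed `w` by at most `M₀` on the edges of `G` with an endpoint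
outside of `V₁`, and the distances in `(G, w)` by at most `M₁` on the pairs in `V₁`. -/
structure IsShortcutting (G : SimpleGraph V) (w : Sym2 V → ℝ) (V₁ : Finset V) (M₀ M₁ : ℝ)
    (H : WeightedGraph V) : Prop where
  le : G ≤ H.1
  shortcutGraph_le : shortcutGraph V₁ ≤ H.1
  wdist_le : ∀ u v, H.1.Adj u v → wdist G w u v ≤ H.2 s(u, v)
  weight_le : ∀ u v, G.Adj u v → u ∉ V₁ → H.2 s(u, v) ≤ w s(u, v) + M₀
  shortcut_le : ∀ u v, (shortcutGraph V₁).Adj u v → H.2 s(u, v) ≤ wdist G w u v + M₁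

/-- The first `L` vertices of the walk meet `V₁`, provided that the walk has at least `L` edges. -/
def MeetsPrefix (V₁ : Finset V) (L : ℕ) {u v : V} (p : G.Walk u v) : Prop :=
  L ≤ p.length → ∃ y ∈ p.support.take L, y ∈ V₁

theorem meetsPrefix_of_cons {L : ℕ} {u v x : V} {h : G.Adj u v} {p : G.Walk v x}
    (hmeets : MeetsPrefix V₁ (L + 1) (Walk.cons h p)) (hu : u ∉ V₁) : MeetsPrefix V₁ L p := by
  intro hL
  obtain ⟨y, hy, hyV₁⟩ := hmeets (Nat.succ_le_succ hL)
  rw [Walk.support_cons, List.take_succ_cons, List.mem_cons] at hy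
  exact ⟨y, hy.resolve_left (ne_of_mem_of_not_mem hyV₁ hu), hyV₁⟩

variable [Finite V]

theorem isShortcutting_syntheticGraph (hw : ∀ e ∈ G.edgeSet, 0 ≤ w e) (hX : ∀ e, 0 ≤ X e)
    (hX₀ : ∀ e ∉ (shortcutGraph V₁).edgeSet, X e ≤ M₀)
    (hX₁ : ∀ e ∈ (shortcutGraph V₁).edgeSet, X e ≤ M₁) :
    IsShortcutting G w V₁ M₀ M₁ (syntheticGraph G w V₁ X) := by
  have hshortcut : ∀ u v, (shortcutGraph V₁).Adj u v →
      (syntheticGraph G w V₁ X).2 s(u, v) = wdist G w u v + X s(u, v) := fun u v h =>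
    if_pos h
  have hedge : ∀ u v, G.Adj u v → ¬(shortcutGraph V₁).Adj u v →
      (syntheticGraph G w V₁ X).2 s(u, v) = w s(u, v) + X s(u, v) := fun u v h h' =>
    (if_neg h').trans (if_pos h)
  refine ⟨le_sup_left, le_sup_right, fun u v huv => ?_, fun u v huv hu => ?_, fun u v huv => ?_⟩
  · by_cases h : (shortcutGraph V₁).Adj u v
    · linarith [hshortcut u v h, hX s(u, v)]
    · have hG := huv.resolve_right h
      linarith [hedge u v hG h, hX s(u, v), wdist_le_of_adj hw hG]
  · have h : ¬(shortcutGraph V₁).Adj u v := fun h => hu h.1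
    linarith [hedge u v huv h, hX₀ s(u, v) h]
  · linarith [hshortcut u v huv, hX₁ s(u, v) huv]

theorem weight_nonneg_of_isShortcutting (hG : G.Connected) (hw : ∀ e ∈ G.edgeSet, 0 ≤ w e)
    (hH : IsShortcutting G w V₁ M₀ M₁ H) : ∀ e ∈ H.1.edgeSet, 0 ≤ H.2 e := by
  intro e he
  induction e with
  | _ u v => exact (wdist_nonneg hG hw u v).trans (hH.wdist_le u v he)

theorem wdist_le_wdist_of_isShortcutting (hG : G.Connected) (hw : ∀ e ∈ G.edgeSet, 0 ≤ w e)
    (hH : IsShortcutting G w V₁ M₀ M₁ H) (u v : V) : wdist G w u v ≤ wdist H.1 H.2 u v :=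
  le_wdist (hG.mono hH.le) (fun u => (wdist_self u).le) (wdist_triangle hG hw) hH.wdist_le u v

theorem wdist_le_add_of_mem_of_mem (hG : G.Connected) (hw : ∀ e ∈ G.edgeSet, 0 ≤ w e)
    (hH : IsShortcutting G w V₁ M₀ M₁ H) (hM₁ : 0 ≤ M₁) {x y : V} (hx : x ∈ V₁) (hy : y ∈ V₁) :
    wdist H.1 H.2 x y ≤ wdist G w x y + M₁ := by
  rcases eq_or_ne x y with rfl | hne
  · simpa only [wdist_self, zero_add] using hM₁
  · have hadj : (shortcutGraph V₁).Adj x y := ⟨hx, hy, hne⟩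
    exact (wdist_le_of_adj (weight_nonneg_of_isShortcutting hG hw hH)
      (hH.shortcutGraph_le hadj)).trans (hH.shortcut_le x y hadj)

theorem exists_wdist_add_wdist_le_of_meetsPrefix (hG : G.Connected)
    (hw : ∀ e ∈ G.edgeSet, 0 ≤ w e) (hH : IsShortcutting G w V₁ M₀ M₁ H) (hM₀ : 0 ≤ M₀) {L : ℕ}
    {u v : V} (p : G.Walk u v) (hp : MeetsPrefix V₁ L p) :
    ∃ x, (x = v ∨ x ∈ V₁) ∧ wdist H.1 H.2 u x + wdist G w x v ≤ walkWeight w p + L * M₀ := by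
  have hstay : ∀ {L : ℕ} {u v : V} (p : G.Walk u v),
      wdist H.1 H.2 u u + wdist G w u v ≤ walkWeight w p + L * M₀ := fun {L} {u v} p => by
    have : 0 ≤ L * M₀ := by positivity
    linarith [wdist_self (G := H.1) (w := H.2) u, wdist_le_walkWeight hw p]
  induction p generalizing L with
  | nil => exact ⟨_, Or.inl rfl, hstay _⟩
  | @cons u a v h p ih =>
    by_cases hu : u ∈ V₁
    · exact ⟨u, Or.inr hu, hstay _⟩
    cases L with
    | zero => simpa using hp (Nat.zero_le _)
    | succ L =>
      obtain ⟨x, hx, hle⟩ := ih (meetsPrefix_of_cons hp hu)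
      refine ⟨x, hx, ?_⟩
      have hnonneg := weight_nonneg_of_isShortcutting hG hw hH
      have htriangle := wdist_triangle (hG.mono hH.le) hnonneg u a x
      have hedge := (wdist_le_of_adj hnonneg (hH.le h)).trans (hH.weight_le u a h hu)
      rw [walkWeight_cons]
      push_cast
      linarith

theorem abs_wdist_sub_wdist_le_of_meetsPrefix (hG : G.Connected) (hw : ∀ e ∈ G.edgeSet, 0 ≤ w e)
    (hH : IsShortcutting G w V₁ M₀ M₁ H) (hM₀ : 0 ≤ M₀) (hM₁ : 0 ≤ M₁) {L : ℕ}
    {p : ∀ u v, G.Path u v} (hp : ∀ u v, walkWeight w (p u v).1 = wdist G w u v)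
    (hmeets : ∀ u v, MeetsPrefix V₁ L (p u v).1) (u v : V) :
    |wdist H.1 H.2 u v - wdist G w u v| ≤ 2 * L * M₀ + M₁ := by
  have hlower := wdist_le_wdist_of_isShortcutting hG hw hH u v
  rw [abs_of_nonneg (sub_nonneg.2 hlower), sub_le_iff_le_add']
  have htriangle := wdist_triangle (hG.mono hH.le) (weight_nonneg_of_isShortcutting hG hw hH)
  have hsegment := fun a b =>
    exists_wdist_add_wdist_le_of_meetsPrefix hG hw hH hM₀ (p a b).1 (hmeets a b)
  simp only [hp] at hsegment
  have : 0 ≤ L * M₀ := by positivity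
  obtain ⟨x, rfl | hx, hux⟩ := hsegment u v
  · linarith [wdist_self (G := G) (w := w) x]
  obtain ⟨y, hy, hvy⟩ := hsegment v x
  have hyV₁ : y ∈ V₁ := hy.elim (· ▸ hx) id
  have hxy := wdist_le_add_of_mem_of_mem hG hw hH hM₁ hx hyV₁
  rw [wdist_comm G w y x, wdist_comm G w v x] at hvy
  rw [wdist_comm H.1 H.2 v y] at hvy
  linarith [htriangle u x v, htriangle x y v]

end Shortcutting

section Sampling

theorem descFactorial_sub_le_pow_mul {n L : ℕ} (hL : L ≤ n) (s : ℕ) :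
    ((n - L).descFactorial s : ℝ) ≤ (1 - L / n) ^ s * n.descFactorial s := by
  have hfactor : (0 : ℝ) ≤ 1 - L / n :=
    sub_nonneg.2 (div_le_one_of_le₀ (Nat.cast_le.2 hL) (Nat.cast_nonneg n))
  induction s with
  | zero => simp
  | succ k ih =>
    have hstep : ((n - L - k : ℕ) : ℝ) ≤ (1 - L / n) * (n - k : ℕ) := by
      rcases le_or_gt (n - L) k with hk | hk
      · rw [Nat.sub_eq_zero_of_le hk, Nat.cast_zero]
        positivity
      · rw [Nat.cast_sub hk.le, Nat.cast_sub hL, Nat.cast_sub (by lia)]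
        have hn : (n : ℝ) ≠ 0 := Nat.cast_ne_zero.2 (by lia)
        have : 0 ≤ (L : ℝ) * k / n := by positivity
        calc (n : ℝ) - L - k ≤ n - L - k + L * k / n := le_add_of_nonneg_right this
          _ = (1 - L / n) * (n - k) := by field_simp; ring
    rw [Nat.descFactorial_succ, Nat.descFactorial_succ, pow_succ, Nat.cast_mul, Nat.cast_mul]
    calc _ ≤ ((1 - (L : ℝ) / n) * (n - k : ℕ)) * ((1 - L / n) ^ k * n.descFactorial k) := by
          gcongr
      _ = _ := by ring

theorem choose_sub_le_exp_mul_choose {n L : ℕ} (hL : L ≤ n) (s : ℕ) :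
    ((n - L).choose s : ℝ) ≤ Real.exp (-(s * L / n)) * n.choose s := by
  have hfactor : (0 : ℝ) ≤ 1 - L / n :=
    sub_nonneg.2 (div_le_one_of_le₀ (Nat.cast_le.2 hL) (Nat.cast_nonneg n))
  have hpow : (1 - (L : ℝ) / n) ^ s ≤ Real.exp (-(s * L / n)) :=
    calc (1 - (L : ℝ) / n) ^ s ≤ Real.exp (-(L / n)) ^ s := by
          gcongr
          exact Real.one_sub_le_exp_neg _
      _ = Real.exp (-(s * L / n)) := by rw [← Real.exp_nat_mul, mul_neg, mul_div_assoc]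
  have hdesc := descFactorial_sub_le_pow_mul hL s
  simp only [Nat.descFactorial_eq_factorial_mul_choose, Nat.cast_mul] at hdesc
  have hs : (0 : ℝ) < s.factorial := Nat.cast_pos.2 s.factorial_pos
  calc ((n - L).choose s : ℝ) ≤ (1 - L / n) ^ s * n.choose s :=
        le_of_mul_le_mul_left (hdesc.trans_eq (mul_left_comm _ _ _)) hs
    _ ≤ Real.exp (-(s * L / n)) * n.choose s := by gcongr

open Classical in
theorem card_filter_exists_disjoint_le {V ι : Type*} [Fintype V] {I : Finset ι}
    {A : ι → Finset V} {L : ℕ} (hA : ∀ i ∈ I, L ≤ (A i).card) (s : ℕ) :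
    (({V₁ ∈ Finset.univ.powersetCard s | ∃ i ∈ I, Disjoint V₁ (A i)} : Finset (Finset V)).card
      : ℝ) ≤ I.card * (Real.exp (-(s * L / Fintype.card V)) * (Fintype.card V).choose s) := by
  have hcover : ({V₁ ∈ Finset.univ.powersetCard s | ∃ i ∈ I, Disjoint V₁ (A i)} :
      Finset (Finset V)) ⊆ I.biUnion fun i => (A i)ᶜ.powersetCard s := fun V₁ hV₁ => by
    obtain ⟨hV₁, i, hi, hdisj⟩ := Finset.mem_filter.1 hV₁
    exact Finset.mem_biUnion.2 ⟨i, hi, Finset.mem_powersetCard.2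
      ⟨Finset.subset_compl_iff_disjoint_right.2 hdisj, (Finset.mem_powersetCard.1 hV₁).2⟩⟩
  have hcard : ∀ i ∈ I, (((A i)ᶜ.powersetCard s).card : ℝ) ≤
      Real.exp (-(s * L / Fintype.card V)) * (Fintype.card V).choose s := fun i hi => by
    rw [Finset.card_powersetCard, Finset.card_compl]
    refine (choose_sub_le_exp_mul_choose (Finset.card_le_univ _) s).trans ?_
    gcongr
    exact hA i hi
  calc _ ≤ ((∑ i ∈ I, ((A i)ᶜ.powersetCard s).card : ℕ) : ℝ) :=
        Nat.cast_le.2 ((Finset.card_le_card hcover).trans Finset.card_biUnion_le)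
    _ ≤ _ := by
        rw [Nat.cast_sum, ← nsmul_eq_mul]
        exact Finset.sum_le_card_nsmul _ _ _ hcard

open Classical in
theorem card_filter_not_meetsPrefix_le {V : Type*} [Fintype V] {G : SimpleGraph V}
    (p : ∀ u v, G.Path u v) (s L : ℕ) :
    (({V₁ ∈ Finset.univ.powersetCard s | ¬∀ u v, MeetsPrefix V₁ L (p u v).1} :
      Finset (Finset V)).card : ℝ) ≤ (Fintype.card V : ℝ) ^ 2 *
        (Real.exp (-(s * L / Fintype.card V)) * (Fintype.card V).choose s) := by
  set I : Finset (V × V) := {x | L ≤ (p x.1 x.2).1.length}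
  set A : V × V → Finset V := fun x => ((p x.1 x.2).1.support.take L).toFinset
  have hA : ∀ x ∈ I, L ≤ (A x).card := fun x hx => by
    have hlength := (Finset.mem_filter.1 hx).2
    rw [List.toFinset_card_of_nodup ((p x.1 x.2).2.support_nodup.sublist (List.take_sublist _ _)),
      List.length_take, Walk.length_support]
    lia
  have hI : (I.card : ℝ) ≤ (Fintype.card V : ℝ) ^ 2 := by
    have := Finset.card_le_univ I
    rw [Fintype.card_prod, ← sq] at this
    exact_mod_cast this
  have hdisj : ({V₁ ∈ Finset.univ.powersetCard s | ¬∀ u v, MeetsPrefix V₁ L (p u v).1} :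
      Finset (Finset V)) ⊆ ({V₁ ∈ Finset.univ.powersetCard s | ∃ x ∈ I, Disjoint V₁ (A x)} :
      Finset (Finset V)) := by
    refine Finset.monotone_filter_right _ fun V₁ _ hV₁ => ?_
    simp only [MeetsPrefix, not_forall, not_exists, not_and] at hV₁
    obtain ⟨u, v, hL, hmiss⟩ := hV₁
    exact ⟨(u, v), Finset.mem_filter.2 ⟨Finset.mem_univ _, hL⟩,
      Finset.disjoint_right.2 fun y hy => hmiss y (List.mem_toFinset.1 hy)⟩
  refine (Nat.cast_le.2 (Finset.card_le_card hdisj)).trans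
    ((card_filter_exists_disjoint_le hA s).trans ?_)
  gcongr

/-- The length of the initial segments of geodesics that a sample of about `√n` vertices misses
with probability at most `γ / n ^ 2`. -/
noncomputable def prefixLength (n : ℕ) (γ : ℝ) : ℕ :=
  ⌈2 * √(n : ℝ) * Real.log ((n : ℝ) ^ 2 / γ)⌉₊

theorem exp_neg_mul_prefixLength_div_le {n s : ℕ} (hn : 0 < n) (hs : √(n : ℝ) / 2 ≤ s) {γ : ℝ}
    (hγ : 0 < γ) : Real.exp (-(s * prefixLength n γ / n)) ≤ γ / n ^ 2 := by
  have hn' : (0 : ℝ) < n := Nat.cast_pos.2 hn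
  rw [← Real.le_log_iff_exp_le (by positivity), ← inv_div _ γ, Real.log_inv, neg_le_neg_iff,
    le_div_iff₀ hn']
  calc Real.log ((n : ℝ) ^ 2 / γ) * n
      = √(n : ℝ) / 2 * (2 * √(n : ℝ) * Real.log ((n : ℝ) ^ 2 / γ)) := by
        linear_combination (-Real.log ((n : ℝ) ^ 2 / γ)) * Real.mul_self_sqrt hn'.le
    _ ≤ √(n : ℝ) / 2 * prefixLength n γ := by
        gcongr
        exact Nat.le_ceil _
    _ ≤ s * prefixLength n γ := by gcongr

open Classical in
theorem card_filter_not_meetsPrefix_prefixLength_le {V : Type*} [Fintype V] [Nonempty V]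
    {G : SimpleGraph V} (p : ∀ u v, G.Path u v) {s : ℕ} (hs : √(Fintype.card V : ℝ) / 2 ≤ s)
    {γ : ℝ} (hγ : 0 < γ) :
    (({V₁ ∈ Finset.univ.powersetCard s |
      ¬∀ u v, MeetsPrefix V₁ (prefixLength (Fintype.card V) γ) (p u v).1} :
        Finset (Finset V)).card : ℝ) ≤
      γ * (Finset.univ.powersetCard s : Finset (Finset V)).card := by
  have : (0 : ℝ) < Fintype.card V := Nat.cast_pos.2 Fintype.card_pos
  refine (card_filter_not_meetsPrefix_le p s _).trans ?_
  rw [Finset.card_powersetCard, Finset.card_univ]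
  calc _ ≤ (Fintype.card V : ℝ) ^ 2 *
        (γ / Fintype.card V ^ 2 * (Fintype.card V).choose s) := by
        gcongr
        exact exp_neg_mul_prefixLength_div_le Fintype.card_pos hs hγ
    _ = γ * (Fintype.card V).choose s := by field_simp

end Sampling

section Utility

theorem ofReal_le_average {α κ : Type*} [MeasurableSpace α] {F : Finset κ} (hF : F.Nonempty)
    {μ : κ → Measure α} {S : Set α} {Q : κ → Prop} [DecidablePred Q] {a b : ℝ} (hb : 0 ≤ b)
    (hbad : ({k ∈ F | ¬Q k}.card : ℝ) ≤ a * F.card)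
    (hgood : ∀ k ∈ F, Q k → ENNReal.ofReal (1 - b) ≤ μ k S) :
    ENNReal.ofReal (1 - (a + b)) ≤ ((F.card : ℝ≥0∞)⁻¹ • ∑ k ∈ F, μ k) S := by
  have hcard : (0 : ℝ) < F.card := Nat.cast_pos.2 hF.card_pos
  have ha : 0 ≤ a := nonneg_of_mul_nonneg_left ((Nat.cast_nonneg _).trans hbad) hcard
  have hcompl : (({k ∈ F | Q k}.card : ℝ)) + {k ∈ F | ¬Q k}.card = F.card := by
    exact_mod_cast Finset.card_filter_add_card_filter_not Q
  have hfraction : 1 - a ≤ (F.card : ℝ)⁻¹ * {k ∈ F | Q k}.card := by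
    rw [inv_mul_eq_div, le_div_iff₀ hcard]
    linarith
  rcases le_total (1 - (a + b)) 0 with hneg | hpos
  · exact (ENNReal.ofReal_of_nonpos hneg).trans_le zero_le
  calc ENNReal.ofReal (1 - (a + b))
      ≤ ENNReal.ofReal ((F.card : ℝ)⁻¹ * {k ∈ F | Q k}.card * (1 - b)) := by
        refine ENNReal.ofReal_le_ofReal ?_
        have : (1 - a) * (1 - b) ≤ (F.card : ℝ)⁻¹ * {k ∈ F | Q k}.card * (1 - b) :=
          mul_le_mul_of_nonneg_right hfraction (by linarith)
        nlinarith [mul_nonneg ha hb]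
    _ = (F.card : ℝ≥0∞)⁻¹ * ∑ k ∈ F with Q k, ENNReal.ofReal (1 - b) := by
        rw [ENNReal.ofReal_mul (by positivity), ENNReal.ofReal_mul (by positivity),
          ENNReal.ofReal_inv_of_pos hcard, ENNReal.ofReal_natCast, ENNReal.ofReal_natCast,
          Finset.sum_const, nsmul_eq_mul, mul_assoc]
    _ ≤ (F.card : ℝ≥0∞)⁻¹ * ∑ k ∈ F with Q k, μ k S := by
        gcongr with k hk
        exact hgood k (Finset.mem_filter.1 hk).1 (Finset.mem_filter.1 hk).2
    _ ≤ (F.card : ℝ≥0∞)⁻¹ * ∑ k ∈ F, μ k S := by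
        gcongr
        exact Finset.filter_subset _ _
    _ = ((F.card : ℝ≥0∞)⁻¹ • ∑ k ∈ F, μ k) S := by
        rw [Measure.smul_apply, Measure.finsetSum_apply, smul_eq_mul]

theorem ofReal_le_pi_laplaceMeasure_abs_sub_le {ι : Type*} [Fintype ι] (m : ι → ℝ) {b c : ι → ℝ}
    (hb : ∀ i, 0 < b i) (hc : ∀ i, 0 ≤ c i) :
    ENNReal.ofReal (1 - ∑ i, Real.exp (-(c i / b i))) ≤
      (Measure.pi fun i => laplaceMeasure (m i) (b i)) {x | ∀ i, |x i - m i| ≤ c i} := by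
  have hprob : ∀ i, IsProbabilityMeasure (laplaceMeasure (m i) (b i)) := fun i =>
    isProbabilityMeasure_laplaceMeasure _ (hb i)
  set P := Measure.pi fun i => laplaceMeasure (m i) (b i)
  have hcoord : ∀ i, P {x | c i < |x i - m i|} = ENNReal.ofReal (Real.exp (-(c i / b i))) :=
    fun i => by
      have hmeas : MeasurableSet {y : ℝ | c i < |y - m i|} :=
        measurableSet_lt measurable_const (by fun_prop)
      rw [← laplaceMeasure_lt_abs_sub (m i) (hb i) (hc i)]
      exact (measurePreserving_eval (fun i => laplaceMeasure (m i) (b i)) i).measure_preimage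
        hmeas.nullMeasurableSet
  have hcompl : {x : ι → ℝ | ∀ i, |x i - m i| ≤ c i}ᶜ = ⋃ i, {x | c i < |x i - m i|} := by
    ext x
    simp
  have hunion : P {x | ∀ i, |x i - m i| ≤ c i}ᶜ ≤
      ENNReal.ofReal (∑ i, Real.exp (-(c i / b i))) := by
    rw [hcompl, ENNReal.ofReal_sum_of_nonneg fun i _ => (Real.exp_pos _).le]
    exact (measure_iUnion_fintype_le _ _).trans_eq (Finset.sum_congr rfl fun i _ => hcoord i)
  rw [ENNReal.ofReal_sub _ (Finset.sum_nonneg fun i _ => (Real.exp_pos _).le), ENNReal.ofReal_one,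
    tsub_le_iff_right]
  calc (1 : ℝ≥0∞) = P Set.univ := measure_univ.symm
    _ ≤ P {x | ∀ i, |x i - m i| ≤ c i} + P {x | ∀ i, |x i - m i| ≤ c i}ᶜ :=
        measure_univ_le_add_compl _
    _ ≤ _ := by gcongr

variable {V : Type*} [Fintype V]

theorem log_pow_div_nonneg {n : ℕ} (hn : 0 < n) {γ : ℝ} (hγ : 0 < γ) (hγ' : γ ≤ 1) (k : ℕ) :
    0 ≤ Real.log ((n : ℝ) ^ k / γ) :=
  Real.log_nonneg ((one_le_div₀ hγ).2 (hγ'.trans (one_le_pow₀ (Nat.one_le_cast.2 hn))))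

theorem noiseMean_nonneg [Nonempty V] (V₁ : Finset V) {ε δ γ : ℝ} (hε : 0 < ε)
    (hδ : 0 < Real.log (1 / δ)) (hγ : 0 < γ) (hγ' : γ ≤ 1) (e : Sym2 V) :
    0 ≤ noiseMean V₁ ε δ γ e := by
  have hlog := log_pow_div_nonneg (Fintype.card_pos (α := V)) hγ hγ'
  unfold noiseMean
  split_ifs
  · exact mul_nonneg (shortcutScale_pos Fintype.card_pos hε hδ).le (by simpa using hlog 1)
  · exact mul_nonneg (edgeScale_pos hε).le (hlog 2)

open Classical in
theorem exp_neg_noiseMean_div_noiseScale [Nonempty V] (V₁ : Finset V) {ε δ γ : ℝ} (hε : 0 < ε)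
    (hδ : 0 < Real.log (1 / δ)) (hγ : 0 < γ) (e : Sym2 V) :
    Real.exp (-(noiseMean V₁ ε δ γ e / noiseScale V₁ ε δ e)) =
      if e ∈ (shortcutGraph V₁).edgeSet then γ / Fintype.card V else γ / Fintype.card V ^ 2 := by
  have : (0 : ℝ) < Fintype.card V := Nat.cast_pos.2 Fintype.card_pos
  unfold noiseMean noiseScale
  split_ifs
  · rw [mul_div_cancel_left₀ _ (shortcutScale_pos Fintype.card_pos hε hδ).ne', ← Real.log_inv,
      Real.exp_log (by positivity), inv_div]
  · rw [mul_div_cancel_left₀ _ (edgeScale_pos hε).ne', ← Real.log_inv,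
      Real.exp_log (by positivity), inv_div]

theorem sum_exp_neg_noiseMean_div_noiseScale_le [Nonempty V] {V₁ : Finset V}
    (hV₁ : V₁.card.choose 2 ≤ Fintype.card V) {ε δ γ : ℝ} (hε : 0 < ε)
    (hδ : 0 < Real.log (1 / δ)) (hγ : 0 < γ) :
    ∑ e, Real.exp (-(noiseMean V₁ ε δ γ e / noiseScale V₁ ε δ e)) ≤ 2 * γ := by
  classical
  have : (0 : ℝ) < Fintype.card V := Nat.cast_pos.2 Fintype.card_pos
  have hshortcut : ((shortcutGraph V₁).edgeFinset.card : ℝ) ≤ Fintype.card V :=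
    Nat.cast_le.2 ((card_edgeFinset_shortcutGraph_le V₁).trans hV₁)
  have hrest : ((shortcutGraph V₁).edgeFinsetᶜ.card : ℝ) ≤ (Fintype.card V : ℝ) ^ 2 := by
    have h := (Finset.card_le_univ (shortcutGraph V₁).edgeFinsetᶜ).trans
      (Fintype.card_le_of_surjective _ (Sym2.mk_surjective (α := V)))
    rw [Fintype.card_prod, ← sq] at h
    exact_mod_cast h
  simp only [exp_neg_noiseMean_div_noiseScale V₁ hε hδ hγ, ← mem_edgeFinset]
  rw [← Finset.sum_add_sum_compl (shortcutGraph V₁).edgeFinset,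
    Finset.sum_congr rfl fun e he => if_pos he,
    Finset.sum_congr rfl fun e he => if_neg (Finset.mem_compl.1 he), Finset.sum_const,
    Finset.sum_const, nsmul_eq_mul, nsmul_eq_mul]
  calc _ ≤ (Fintype.card V : ℝ) * (γ / Fintype.card V) +
        (Fintype.card V : ℝ) ^ 2 * (γ / Fintype.card V ^ 2) := by gcongr
    _ = 2 * γ := by field_simp; ring

theorem ofReal_le_noiseLaw_abs_sub_noiseMean_le [Nonempty V] {V₁ : Finset V}
    (hV₁ : V₁.card.choose 2 ≤ Fintype.card V) {ε δ γ : ℝ} (hε : 0 < ε)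
    (hδ : 0 < Real.log (1 / δ)) (hγ : 0 < γ) (hγ' : γ ≤ 1) :
    ENNReal.ofReal (1 - 2 * γ) ≤
      noiseLaw V₁ ε δ γ {X | ∀ e, |X e - noiseMean V₁ ε δ γ e| ≤ noiseMean V₁ ε δ γ e} := by
  rw [noiseLaw_eq_pi]
  refine le_trans (ENNReal.ofReal_le_ofReal ?_) (ofReal_le_pi_laplaceMeasure_abs_sub_le _
    (noiseScale_pos V₁ hε hδ) (noiseMean_nonneg V₁ hε hδ hγ hγ'))
  exact sub_le_sub_left (sum_exp_neg_noiseMean_div_noiseScale_le hV₁ hε hδ hγ) 1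

/-- The error of the estimated distances when every noise coordinate is at most twice its mean:
a geodesic reaches the sample at either end over at most `prefixLength n γ` edges, and in between
one shortcut edge is used. -/
noncomputable def errorBound (n : ℕ) (ε δ γ : ℝ) : ℝ :=
  2 * prefixLength n γ * (2 * (edgeScale ε * Real.log ((n : ℝ) ^ 2 / γ))) +
    2 * (shortcutScale n ε δ * Real.log (n / γ))

theorem abs_wdist_syntheticGraph_sub_wdist_le_errorBound {G : SimpleGraph V} (hG : G.Connected)
    {w : Sym2 V → ℝ} (hw : ∀ e ∈ G.edgeSet, 0 ≤ w e) {V₁ : Finset V} {ε δ γ : ℝ} (hε : 0 < ε)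
    (hδ : 0 < Real.log (1 / δ)) (hγ : 0 < γ) (hγ' : γ ≤ 1) {p : ∀ u v, G.Path u v}
    (hp : ∀ u v, walkWeight w (p u v).1 = wdist G w u v)
    (hmeets : ∀ u v, MeetsPrefix V₁ (prefixLength (Fintype.card V) γ) (p u v).1)
    {X : Sym2 V → ℝ} (hX : ∀ e, |X e - noiseMean V₁ ε δ γ e| ≤ noiseMean V₁ ε δ γ e) (u v : V) :
    |wdist (syntheticGraph G w V₁ X).1 (syntheticGraph G w V₁ X).2 u v - wdist G w u v| ≤
      errorBound (Fintype.card V) ε δ γ := by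
  have := hG.nonempty
  have hnonneg : ∀ e, 0 ≤ X e := fun e => by linarith [(abs_le.1 (hX e)).1]
  have hle : ∀ e, X e ≤ 2 * noiseMean V₁ ε δ γ e := fun e => by linarith [(abs_le.1 (hX e)).2]
  have hlog := log_pow_div_nonneg (Fintype.card_pos (α := V)) hγ hγ'
  refine abs_wdist_sub_wdist_le_of_meetsPrefix hG hw (isShortcutting_syntheticGraph hw hnonneg
    (fun e he => ?_) fun e he => ?_) ?_ ?_ hp hmeets u v
  · exact (hle e).trans_eq (by rw [noiseMean, if_neg he])
  · exact (hle e).trans_eq (by rw [noiseMean, if_pos he])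
  · exact mul_nonneg zero_le_two (mul_nonneg (edgeScale_pos hε).le (hlog 2))
  · exact mul_nonneg zero_le_two
      (mul_nonneg (shortcutScale_pos Fintype.card_pos hε hδ).le (by simpa using hlog 1))

theorem ofReal_le_privateAPSP_errorBound {G : SimpleGraph V} (hG : G.Connected)
    {w : Sym2 V → ℝ} (hw : ∀ e ∈ G.edgeSet, 0 ≤ w e) {s : ℕ} (hs : s ≤ Fintype.card V)
    (hs_choose : s.choose 2 ≤ Fintype.card V) (hs_sqrt : √(Fintype.card V : ℝ) / 2 ≤ s)
    {ε δ γ : ℝ} (hε : 0 < ε) (hδ : 0 < Real.log (1 / δ)) (hγ : 0 < γ) (hγ' : γ ≤ 1) :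
    ENNReal.ofReal (1 - 3 * γ) ≤ privateAPSP G s ε δ γ w
      {H | ∀ u v, |wdist H.1 H.2 u v - wdist G w u v| ≤ errorBound (Fintype.card V) ε δ γ} := by
  classical
  have := hG.nonempty
  choose p hp using exists_path_walkWeight_eq_wdist hG w
  have hsamples : (Finset.univ.powersetCard s : Finset (Finset V)).Nonempty :=
    Finset.powersetCard_nonempty.2 hs
  rw [show 1 - 3 * γ = 1 - (γ + 2 * γ) by ring]
  refine ofReal_le_average hsamples (by positivity)
    (card_filter_not_meetsPrefix_prefixLength_le p hs_sqrt hγ) fun V₁ hV₁ hmeets => ?_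
  have hV₁_choose : V₁.card.choose 2 ≤ Fintype.card V :=
    (Finset.mem_powersetCard.1 hV₁).2.symm ▸ hs_choose
  calc _ ≤ _ := ofReal_le_noiseLaw_abs_sub_noiseMean_le hV₁_choose hε hδ hγ hγ'
    _ ≤ noiseLaw V₁ ε δ γ (syntheticGraph G w V₁ ⁻¹' {H | ∀ u v,
          |wdist H.1 H.2 u v - wdist G w u v| ≤ errorBound (Fintype.card V) ε δ γ}) :=
        measure_mono fun X hX =>
          abs_wdist_syntheticGraph_sub_wdist_le_errorBound hG hw hε hδ hγ hγ' hp hmeets hX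
    _ ≤ _ := Measure.le_map_apply (measurable_syntheticGraph G w V₁).aemeasurable _

end Utility

section Asymptotics

variable {n : ℕ} {ε δ γ : ℝ}

theorem one_le_two_mul_log_div (hn : 2 ≤ n) (hγ : 0 < γ) (hγ' : γ ≤ 1) :
    1 ≤ 2 * Real.log (n / γ) := by
  have hn' : (2 : ℝ) ≤ n := by exact_mod_cast hn
  have hle : (2 : ℝ) ≤ n / γ := hn'.trans (le_div_self (by positivity) hγ hγ')
  linarith [Real.log_two_gt_d9, Real.log_le_log two_pos hle]

theorem log_sq_div_le_two_mul_log_div (hn : 0 < n) (hγ : 0 < γ) (hγ' : γ ≤ 1) :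
    Real.log ((n : ℝ) ^ 2 / γ) ≤ 2 * Real.log (n / γ) := by
  have : (0 : ℝ) < n := Nat.cast_pos.2 hn
  have hlog : 2 * Real.log (n / γ) = Real.log ((n / γ) ^ 2) := by
    rw [Real.log_pow, Nat.cast_ofNat]
  rw [hlog, div_pow]
  gcongr
  exact pow_le_of_le_one hγ.le hγ' two_ne_zero

theorem prefixLength_le (hn : 2 ≤ n) (hγ : 0 < γ) (hγ' : γ ≤ 1) :
    (prefixLength n γ : ℝ) ≤ 6 * (√(n : ℝ) * Real.log (n / γ)) := by
  have hsqrt : 1 ≤ √(n : ℝ) := Real.one_le_sqrt.2 (by exact_mod_cast one_le_two.trans hn)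
  have hlog := one_le_two_mul_log_div hn hγ hγ'
  have hlog_sq := log_pow_div_nonneg (two_pos.trans_le hn) hγ hγ' 2
  calc (prefixLength n γ : ℝ) ≤ 2 * √(n : ℝ) * Real.log ((n : ℝ) ^ 2 / γ) + 1 :=
        (Nat.ceil_lt_add_one (by positivity)).le
    _ ≤ 2 * √(n : ℝ) * (2 * Real.log (n / γ)) + √(n : ℝ) * (2 * Real.log (n / γ)) := by
        gcongr
        · exact log_sq_div_le_two_mul_log_div (by lia) hγ hγ'
        · exact one_le_mul_of_one_le_of_one_le hsqrt hlog
    _ = 6 * (√(n : ℝ) * Real.log (n / γ)) := by ring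

theorem shortcutScale_le (n : ℕ) (hε : 0 < ε) (δ : ℝ) :
    shortcutScale n ε δ ≤ 6 * (ε⁻¹ * √(n : ℝ) * √(Real.log (1 / δ))) := by
  have hsqrt : √2 ≤ 3 / 2 := Real.sqrt_le_iff.2 (by norm_num)
  calc shortcutScale n ε δ = 4 * √2 * (ε⁻¹ * √(n : ℝ) * √(Real.log (1 / δ))) := by
        rw [shortcutScale]
        field_simp
        ring
    _ ≤ 6 * (ε⁻¹ * √(n : ℝ) * √(Real.log (1 / δ))) := by
        gcongr
        linarith

theorem log_two_le_log_one_div (hδ : 0 < δ) (hδ' : δ ≤ 1 / 2) :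
    Real.log 2 ≤ Real.log (1 / δ) :=
  Real.log_le_log two_pos ((le_one_div two_pos hδ).2 hδ')

theorem one_le_two_mul_sqrt_log_one_div (hδ : 0 < δ) (hδ' : δ ≤ 1 / 2) :
    1 ≤ 2 * √(Real.log (1 / δ)) := by
  have : 1 / 2 ≤ √(Real.log (1 / δ)) := Real.le_sqrt_of_sq_le
    (by linarith [Real.log_two_gt_d9, log_two_le_log_one_div hδ hδ'])
  linarith

theorem errorBound_le (hn : 2 ≤ n) (hε : 0 < ε) (hδ : 0 < δ) (hδ' : δ ≤ 1 / 2) (hγ : 0 < γ)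
    (hγ' : γ ≤ 1) :
    errorBound n ε δ γ ≤
      216 * (ε⁻¹ * √(n : ℝ) * Real.log (n / γ) ^ 2 * √(Real.log (1 / δ))) := by
  have hlog_sq := log_pow_div_nonneg (two_pos.trans_le hn) hγ hγ' 2
  have hlog_sq' := log_sq_div_le_two_mul_log_div (two_pos.trans_le hn) hγ hγ'
  have hprefix := prefixLength_le hn hγ hγ'
  have hshortcut := shortcutScale_le n hε δ
  have hedge : edgeScale ε = 2 * ε⁻¹ := by rw [edgeScale, one_div_div, div_eq_mul_inv]
  have hℓ := one_le_two_mul_log_div hn hγ hγ'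
  have hΛ := one_le_two_mul_sqrt_log_one_div hδ hδ'
  rw [errorBound, hedge]
  set ℓ := Real.log (n / γ)
  set Λ := √(Real.log (1 / δ))
  set r := √(n : ℝ)
  have hℓ_nonneg : 0 ≤ ℓ := by linarith
  calc _ ≤ 2 * (6 * (r * ℓ)) * (2 * (2 * ε⁻¹ * (2 * ℓ))) + 2 * (6 * (ε⁻¹ * r * Λ) * ℓ) := by
        gcongr
    _ = 96 * (ε⁻¹ * r * ℓ ^ 2) * 1 + 12 * (ε⁻¹ * r * ℓ * Λ) * 1 := by ring
    _ ≤ 96 * (ε⁻¹ * r * ℓ ^ 2) * (2 * Λ) + 12 * (ε⁻¹ * r * ℓ * Λ) * (2 * ℓ) := by gcongr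
    _ = 216 * (ε⁻¹ * r * ℓ ^ 2 * Λ) := by ring

end Asymptotics

section SampleSize

variable {n s : ℕ}

theorem le_of_eq_floor_or_ceil_sqrt (hs : s = ⌊√(n : ℝ)⌋₊ ∨ s = ⌈√(n : ℝ)⌉₊) : s ≤ n := by
  have hsqrt : √(n : ℝ) ≤ n :=
    Real.sqrt_le_iff.2 ⟨n.cast_nonneg, by exact_mod_cast Nat.le_self_pow two_ne_zero n⟩
  rcases hs with rfl | rfl
  · exact Nat.floor_le_of_le hsqrt
  · exact Nat.ceil_le.2 hsqrt

theorem choose_two_le_of_eq_floor_or_ceil_sqrt (hs : s = ⌊√(n : ℝ)⌋₊ ∨ s = ⌈√(n : ℝ)⌉₊) :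
    s.choose 2 ≤ n := by
  have hlt : (s : ℝ) < √n + 1 := by
    rcases hs with rfl | rfl
    · exact (Nat.floor_le (Real.sqrt_nonneg _)).trans_lt (lt_add_one _)
    · exact Nat.ceil_lt_add_one (Real.sqrt_nonneg _)
  rcases Nat.eq_zero_or_pos n with rfl | hpos
  · simp_all
  have hsqrt : 1 ≤ √(n : ℝ) := Real.one_le_sqrt.2 (Nat.one_le_cast.2 hpos)
  have hsq : √(n : ℝ) * √n = n := Real.mul_self_sqrt n.cast_nonneg
  rw [← Nat.cast_le (α := ℝ), Nat.cast_choose_two, div_le_iff₀ two_pos]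
  nlinarith [(s.cast_nonneg : (0 : ℝ) ≤ s)]

theorem sqrt_div_two_le_of_eq_floor_or_ceil_sqrt (hn : 0 < n)
    (hs : s = ⌊√(n : ℝ)⌋₊ ∨ s = ⌈√(n : ℝ)⌉₊) : √(n : ℝ) / 2 ≤ s := by
  have hsqrt : 1 ≤ √(n : ℝ) := Real.one_le_sqrt.2 (Nat.one_le_cast.2 hn)
  rcases hs with rfl | rfl
  · have hone : (1 : ℝ) ≤ ⌊√(n : ℝ)⌋₊ := Nat.one_le_cast.2 ((Nat.one_le_floor_iff _).2 hsqrt)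
    linarith [Nat.lt_floor_add_one √(n : ℝ)]
  · linarith [Nat.le_ceil √(n : ℝ)]

end SampleSize

end PrivateAPSP

open PrivateAPSP in
theorem mainTheorem1_general :
    ∃ C : ℝ, 0 < C ∧
      ∀ (V : Type*) [Fintype V] (G : SimpleGraph V), G.Connected →
      ∀ s : ℕ, s ≤ Fintype.card V → s.choose 2 ≤ Fintype.card V →
        √(Fintype.card V : ℝ) / 2 ≤ s →
      ∀ ε δ γ : ℝ, 0 < ε → 0 < δ → 0 < γ →
        (ε ≤ 16 * Real.log (1 / δ) →
          SimpleGraph.IsDP G ε δ (SimpleGraph.privateAPSP G s ε δ γ)) ∧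
        (δ ≤ 1 / 2 → ∀ w : Sym2 V → ℝ, (∀ e ∈ G.edgeSet, 0 ≤ w e) →
          ENNReal.ofReal (1 - 3 * γ) ≤
            SimpleGraph.privateAPSP G s ε δ γ w
              {H | ∀ u v : V,
                |SimpleGraph.wdist H.1 H.2 u v - SimpleGraph.wdist G w u v| ≤
                  C * (ε⁻¹ * √(Fintype.card V : ℝ) *
                    Real.log (Fintype.card V / γ) ^ 2 * √(Real.log (1 / δ)))}) := by
  refine ⟨216, by norm_num, fun V _ G hG s hs hs_choose hs_sqrt ε δ γ hε hδ hγ =>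
    ⟨fun hεδ => isDP_privateAPSP hG hs_choose hε hδ hεδ γ, fun hδ' w hw => ?_⟩⟩
  rcases lt_or_ge 1 γ with hγ' | hγ'
  · exact (ENNReal.ofReal_of_nonpos (by linarith)).trans_le zero_le
  have hlog := (Real.log_pos one_lt_two).trans_le (log_two_le_log_one_div hδ hδ')
  refine (ofReal_le_privateAPSP_errorBound hG hw hs hs_choose hs_sqrt hε hlog hγ hγ').trans
    (measure_mono fun H hH u v => ?_)
  rcases eq_or_ne u v with rfl | hne
  · rw [wdist_self, wdist_self, sub_zero, abs_zero]
    positivity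
  · exact (hH u v).trans
      (errorBound_le (Fintype.one_lt_card_iff.2 ⟨u, v, hne⟩) hε hδ hδ' hγ hγ')

theorem mainTheorem1 :
    ∃ C : ℝ, 0 < C ∧
      ∀ (V : Type*) [Fintype V] (G : SimpleGraph V), G.Connected →
      ∀ s : ℕ, (s = ⌊√(Fintype.card V : ℝ)⌋₊ ∨ s = ⌈√(Fintype.card V : ℝ)⌉₊) →
      ∀ ε δ γ : ℝ, 0 < ε → 0 < δ → δ ≤ 1 / 2 → 0 < γ → γ < 1 →
        (ε < 2 → SimpleGraph.IsDP G ε δ (SimpleGraph.privateAPSP G s ε δ γ)) ∧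
        ∀ w : Sym2 V → ℝ, (∀ e ∈ G.edgeSet, 0 ≤ w e) →
          ENNReal.ofReal (1 - 4 * γ) ≤
            SimpleGraph.privateAPSP G s ε δ γ w
              {H | ∀ u v : V,
                |SimpleGraph.wdist H.1 H.2 u v - SimpleGraph.wdist G w u v| ≤
                  C * (ε⁻¹ * √(Fintype.card V : ℝ) *
                    Real.log (Fintype.card V / γ) ^ 2 * √(Real.log (1 / δ)))} := by
  obtain ⟨C, hC, h⟩ := mainTheorem1_general
  refine ⟨C, hC, fun V _ G hG s hs ε δ γ hε hδ hδ' hγ _ => ?_⟩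
  have := hG.nonempty
  obtain ⟨hprivacy, hutility⟩ := h V G hG s (PrivateAPSP.le_of_eq_floor_or_ceil_sqrt hs)
    (PrivateAPSP.choose_two_le_of_eq_floor_or_ceil_sqrt hs)
    (PrivateAPSP.sqrt_div_two_le_of_eq_floor_or_ceil_sqrt Fintype.card_pos hs) ε δ γ hε hδ hγ
  refine ⟨fun hε' => hprivacy ?_, fun w hw => le_trans ?_ (hutility hδ' w hw)⟩
  · linarith [Real.log_two_gt_d9, PrivateAPSP.log_two_le_log_one_div hδ hδ']
  · exact ENNReal.ofReal_le_ofReal (by linarith)
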